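/- Let $\mu\in\mathbb R$ and $\sigma>0$, and let $f_X$ and $F_X$ be the density and the cumulative distribution function of $X\sim\mathcal N(\mu,\sigma)$ (mean $\mu$, standard deviation $\sigma$). For $\alpha\in\mathbb R$ put $$I(\mu,\sigma,\alpha)=(\mu-\alpha)\,(1-F_X(\alpha))+\sigma^2 f_X(\alpha).$$ For $n\ge 2$ let $X_1,\dots,X_n$ be independent with law $\mathcal N(\mu,\sigma)$, let $\hat\mu=\frac1n\sum_i X_i$ and $\hat\sigma=\sqrt{\frac1{n-1}\sum_i (X_i-\hat\mu)^2}$, and let $$err_{ma}(n,\alpha)=\mathbb E\,\bigl|\,I(\mu,\sigma,\alpha)-I(\hat\mu,\hat\sigma,\alpha)\,\bigr|,$$ where $\alpha$ is a fixed real number. Then for every $n\ge2$ and every $\alpha\ge\mu+\sqrt{3/2}\,\sigma$, $$err_{ma}(n,\alpha)\;\ge\;\frac{\sigma}{2e^{3/2}n}\Bigl(\frac{\alpha-\mu}{\sigma}\Bigr)^2 f_Z\Bigl(\frac{\alpha-\mu}{\sigma}\Bigr),$$ where $f_Z(z)=\frac1{\sqrt{2\pi}}e^{-z^2/2}$ is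 the standard normal density (so that $f_Z(\frac{\alpha-\mu}{\sigma})=\sigma f_X(\alpha)$). Consequently, for fixed $\mu$ and $\sigma$, $err_{ma}(n,\alpha)=\Omega\bigl(\alpha^2 f_X(\alpha)/n\bigr)$: there is $c>0$, depending only on $\mu$ and $\sigma$, such that $err_{ma}(n,\alpha)\ge c\,\alpha^2 f_X(\alpha)/n$ for all $n\ge 2$ and all $\alpha\ge\mu+\sqrt{3/2}\,\sigma$. -/

import Mathlib

open MeasureTheory ProbabilityTheory

noncomputable section

/-- The normal law with mean `μ` and standard deviation `σ` (variance `σ ^ 2`). -/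
def normalLaw (μ σ : ℝ) : Measure ℝ := gaussianReal μ (σ ^ 2).toNNReal

/-- The density of the normal law with mean `μ` and standard deviation `σ`. -/
def normalDensity (μ σ : ℝ) (x : ℝ) : ℝ := gaussianPDFReal μ (σ ^ 2).toNNReal x

/-- `I(μ, σ, α) = (μ - α) (1 - F_X(α)) + σ² f_X(α)`, where `F_X` and `f_X` are the cumulative
distribution function and the density of `X ∼ N(μ, σ)`. -/
def expImprovement (μ σ α : ℝ) : ℝ :=
  (μ - α) * (1 - cdf (normalLaw μ σ) α) + σ ^ 2 * normalDensity μ σ α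

/-- The empirical mean `μ̂` of the sample `x₁, …, xₙ`. -/
def sampleMean {n : ℕ} (x : Fin n → ℝ) : ℝ := (∑ i, x i) / n

/-- The empirical standard deviation `σ̂` of the sample `x₁, …, xₙ`, with normalisation
`1 / (n - 1)` under the square root. -/
def sampleSD {n : ℕ} (x : Fin n → ℝ) : ℝ :=
  Real.sqrt ((∑ i, (x i - sampleMean x) ^ 2) / ((n : ℝ) - 1))

/-- The mean absolute error `E |I(μ, σ, α) - I(μ̂, σ̂, α)|`, where `μ̂, σ̂` are computed from
`n` independent samples of `N(μ, σ)`, that is, from the product law on `Fin n → ℝ`. -/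
def errMA (μ σ : ℝ) (n : ℕ) (α : ℝ) : ℝ :=
  ∫ x : Fin n → ℝ,
    |expImprovement μ σ α - expImprovement (sampleMean x) (sampleSD x) α|
      ∂(Measure.pi fun _ : Fin n => normalLaw μ σ)

end

/-! Write Ψ = `stdExcess`, φ = `stdPDF`, z = (α - μ)/σ. By affine equivariance the error is σ E|Ψ(z)
- I(μ̂, σ̂, z)| for a standard normal sample, where I(m, s, z) = sΨ((z - m)/s) for s > 0. The
reflection x ↦ -x preserves the law, fixes σ̂ and negates μ̂, so averaging over it and using
convexity of Ψ removes μ̂ (`two_mul_stdExcess_le`). What remains is sΨ(z/s) - Ψ(z), whose derivative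
in s is φ(z/s); bounding this below and integrating from 1 gives φ(z)(e/2)z²(s + 1/s - 2) for s ≥ 1
(`mul_stdExcess_div_sub_ge`). Samples with σ̂ ≤ 1 are discarded.

It remains to prove E[σ̂ + 1/σ̂ - 2; σ̂ > 1] ≥ e^(-5/2)/n (`integral_excessGap_sampleSD_ge`). Since
√(n-1) σ̂ is distributed as the norm of a standard Gaussian vector in dimension n - 1, this
expectation is a quotient of radial integrals. The denominator is bounded above by a Stirling-type
inequality, the numerator below by a Gaussian comparison near s = 1 and Jensen's inequality for u⁻².
-/

/-! ### The standard normal excess function. -/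

/-- The density of the standard normal law. -/
noncomputable abbrev stdPDF (x : ℝ) : ℝ := gaussianPDFReal 0 1 x

/-- The cumulative distribution function of the standard normal law. -/
noncomputable def stdCDF (x : ℝ) : ℝ := cdf (gaussianReal 0 1) x

/-- The expected excess `E (Z - z)⁺` of a standard normal variable `Z` over `z`. -/
noncomputable def stdExcess (z : ℝ) : ℝ := stdPDF z - z * (1 - stdCDF z)

lemma stdPDF_eq (x : ℝ) : stdPDF x = (√(2 * Real.pi))⁻¹ * Real.exp (-x ^ 2 / 2) := by
  simp [stdPDF, gaussianPDFReal]

lemma continuous_stdPDF : Continuous stdPDF := by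
  have : stdPDF = fun x => (√(2 * Real.pi))⁻¹ * Real.exp (-x ^ 2 / 2) := funext stdPDF_eq
  rw [this]; fun_prop

lemma stdPDF_le_one (x : ℝ) : stdPDF x ≤ 1 := by
  rw [stdPDF_eq]
  have h1 : (√(2 * Real.pi))⁻¹ ≤ 1 := by
    apply inv_le_one_of_one_le₀
    rw [Real.one_le_sqrt]
    linarith [Real.pi_gt_three]
  have h2 : Real.exp (-x ^ 2 / 2) ≤ 1 := Real.exp_le_one_iff.2 (by nlinarith [sq_nonneg x])
  exact mul_le_one₀ h1 (Real.exp_pos _).le h2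

lemma hasDerivAt_stdPDF (x : ℝ) : HasDerivAt stdPDF (-x * stdPDF x) x := by
  have h : stdPDF = fun x => (√(2 * Real.pi))⁻¹ * Real.exp (-x ^ 2 / 2) := funext stdPDF_eq
  have h1 : HasDerivAt (fun x : ℝ => -x ^ 2 / 2) (-x) x := by
    have := ((hasDerivAt_pow 2 x).neg.div_const 2)
    convert! this using 1
    norm_num
    ring
  have h2 := h1.exp.const_mul (√(2 * Real.pi))⁻¹
  rw [stdPDF_eq, h]
  convert! h2 using 1
  ring

lemma stdCDF_eq_integral (x : ℝ) : stdCDF x = ∫ y in Set.Iic x, stdPDF y := by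
  rw [stdCDF, cdf_eq_real, measureReal_def, gaussianReal_apply_eq_integral _ one_ne_zero,
    ENNReal.toReal_ofReal]
  exact setIntegral_nonneg measurableSet_Iic fun y _ => gaussianPDFReal_nonneg _ _ _

lemma hasDerivAt_stdCDF (x : ℝ) : HasDerivAt stdCDF (stdPDF x) x := by
  have hint : Integrable stdPDF := integrable_gaussianPDFReal 0 1
  have h : ∀ y, stdCDF y = stdCDF 0 + ∫ t in (0 : ℝ)..y, stdPDF t := by
    intro y
    rw [← intervalIntegral.integral_Iic_sub_Iic hint.integrableOn hint.integrableOn,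
      stdCDF_eq_integral, stdCDF_eq_integral]
    ring
  rw [show stdCDF = fun y => stdCDF 0 + ∫ t in (0 : ℝ)..y, stdPDF t from funext h]
  exact (intervalIntegral.integral_hasDerivAt_right (hint.intervalIntegrable)
    (continuous_stdPDF.stronglyMeasurableAtFilter _ _) continuous_stdPDF.continuousAt).const_add _

lemma hasDerivAt_stdExcess (z : ℝ) : HasDerivAt stdExcess (stdCDF z - 1) z := by
  have h := (hasDerivAt_stdPDF z).sub
    ((hasDerivAt_id z).mul ((hasDerivAt_const z (1 : ℝ)).sub (hasDerivAt_stdCDF z)))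
  convert! h using 1
  simp

lemma convexOn_stdExcess : ConvexOn ℝ Set.univ stdExcess := by
  apply Monotone.convexOn_univ_of_deriv fun z => (hasDerivAt_stdExcess z).differentiableAt
  intro a b hab
  rw [(hasDerivAt_stdExcess a).deriv, (hasDerivAt_stdExcess b).deriv]
  exact sub_le_sub_right (monotone_cdf _ hab) 1

lemma two_mul_stdExcess_le (z h : ℝ) :
    2 * stdExcess z ≤ stdExcess (z - h) + stdExcess (z + h) := by
  have := convexOn_stdExcess.2 (Set.mem_univ (z - h)) (Set.mem_univ (z + h))
    (by norm_num : (0 : ℝ) ≤ 1 / 2) (by norm_num : (0 : ℝ) ≤ 1 / 2) (by norm_num)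
  simp only [smul_eq_mul] at this
  rw [show 1 / 2 * (z - h) + 1 / 2 * (z + h) = z by ring] at this
  linarith

/-- With w = z/s the derivative is Ψ(w) - wΨ'(w), where the `stdCDF` terms cancel. -/
lemma hasDerivAt_mul_stdExcess_div (z : ℝ) {s : ℝ} (hs : s ≠ 0) :
    HasDerivAt (fun s => s * stdExcess (z / s)) (stdPDF (z / s)) s := by
  have h1 : HasDerivAt (fun s : ℝ => z / s) (-z / s ^ 2) s := by
    have := (hasDerivAt_inv hs).const_mul z
    convert! this using 1
    ring
  have h := (hasDerivAt_id s).mul ((hasDerivAt_stdExcess (z / s)).comp s h1)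
  convert! h using 1
  simp only [id, Function.comp, stdExcess]
  field_simp
  ring

lemma stdPDF_div_ge (z : ℝ) {s : ℝ} (hs : 1 ≤ s) :
    stdPDF z * (Real.exp 1 / 2) * z ^ 2 * (1 - (s ^ 2)⁻¹) ≤ stdPDF (z / s) := by
  have hs0 : s ≠ 0 := by linarith
  set x := z ^ 2 / 2 * (1 - (s ^ 2)⁻¹) with hx
  -- Tangent line of exp at 1, the source of the factor e/2.
  have h1 : Real.exp 1 * x ≤ Real.exp x := by
    have := Real.add_one_le_exp (x - 1)
    have h2 : Real.exp x = Real.exp 1 * Real.exp (x - 1) := by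
      rw [← Real.exp_add]; congr 1; ring
    rw [h2]
    exact mul_le_mul_of_nonneg_left (by linarith) (Real.exp_pos 1).le
  have h3 : stdPDF (z / s) = stdPDF z * Real.exp x := by
    rw [stdPDF_eq, stdPDF_eq, mul_assoc, ← Real.exp_add]
    congr 2
    rw [hx]
    field_simp
    ring
  rw [h3]
  calc _ = stdPDF z * (Real.exp 1 * x) := by rw [hx]; ring
    _ ≤ _ := mul_le_mul_of_nonneg_left h1 (gaussianPDFReal_nonneg _ _ _)

/-- Both sides vanish at s = 1, and `stdPDF_div_ge` compares their derivatives. -/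
lemma mul_stdExcess_div_sub_ge (z : ℝ) {s : ℝ} (hs : 1 ≤ s) :
    stdPDF z * (Real.exp 1 / 2) * z ^ 2 * (s + s⁻¹ - 2) ≤ s * stdExcess (z / s) - stdExcess z := by
  set C := stdPDF z * (Real.exp 1 / 2) * z ^ 2 with hC
  set F : ℝ → ℝ := fun s => s * stdExcess (z / s) - C * (s + s⁻¹) with hF
  have hd : ∀ s : ℝ, s ≠ 0 → HasDerivAt F (stdPDF (z / s) - C * (1 - (s ^ 2)⁻¹)) s := by
    intro s hs
    have := (hasDerivAt_mul_stdExcess_div z hs).sub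
      (((hasDerivAt_id s).add (hasDerivAt_inv hs)).const_mul C)
    convert! this using 1
  have hmono : MonotoneOn F (Set.Ici 1) := by
    apply monotoneOn_of_deriv_nonneg (convex_Ici 1)
    · intro s hs
      exact (hd s (by have := Set.mem_Ici.1 hs; linarith)).continuousAt.continuousWithinAt
    · intro s hs
      rw [interior_Ici] at hs
      exact (hd s (by have := Set.mem_Ioi.1 hs; linarith)).differentiableAt.differentiableWithinAt
    · intro s hs
      rw [interior_Ici] at hs
      have hs' := Set.mem_Ioi.1 hs
      rw [(hd s (by linarith)).deriv]
      have := stdPDF_div_ge z hs'.le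
      rw [← hC] at this
      linarith
  have := hmono (Set.mem_Ici.2 le_rfl) (Set.mem_Ici.2 hs) hs
  simp only [hF, one_mul, div_one, inv_one] at this
  linarith

/-! ### Scaling form of the improvement function. -/

lemma normalDensity_of_pos (m : ℝ) {s : ℝ} (hs : 0 < s) (a : ℝ) :
    normalDensity m s a = stdPDF ((a - m) / s) / s := by
  rw [normalDensity, stdPDF_eq, gaussianPDFReal, Real.coe_toNNReal _ (sq_nonneg s),
    Real.sqrt_mul (by positivity), Real.sqrt_sq hs.le]
  rw [show -(a - m) ^ 2 / (2 * s ^ 2) = -((a - m) / s) ^ 2 / 2 by field_simp]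
  field_simp

lemma normalLaw_eq_map (m s : ℝ) :
    normalLaw m s = (gaussianReal 0 1).map (fun y => m + s * y) := by
  have : (fun y => m + s * y) = (fun y => m + y) ∘ (fun y => s * y) := rfl
  rw [this, ← Measure.map_map (by fun_prop) (by fun_prop), gaussianReal_map_const_mul,
    gaussianReal_map_const_add, normalLaw]
  congr 1
  · ring
  · ext
    simp [sq_nonneg]

lemma cdf_normalLaw_of_pos (m : ℝ) {s : ℝ} (hs : 0 < s) (a : ℝ) :
    cdf (normalLaw m s) a = stdCDF ((a - m) / s) := by
  have : IsProbabilityMeasure (normalLaw m s) := by unfold normalLaw; infer_instance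
  rw [stdCDF, cdf_eq_real, cdf_eq_real, normalLaw_eq_map, map_measureReal_apply (by fun_prop)
    measurableSet_Iic]
  congr 1
  ext y
  simp only [Set.mem_preimage, Set.mem_Iic]
  rw [le_div_iff₀ hs]
  constructor <;> intro h <;> linarith

lemma expImprovement_of_pos (m : ℝ) {s : ℝ} (hs : 0 < s) (a : ℝ) :
    expImprovement m s a = s * stdExcess ((a - m) / s) := by
  rw [expImprovement, cdf_normalLaw_of_pos m hs, normalDensity_of_pos m hs, stdExcess]
  field_simp
  ring

/-- A constant sample has σ̂ = 0; treating this Dirac case makes the later identities hold for every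
sample, not just almost surely. -/
lemma expImprovement_zero (m a : ℝ) : expImprovement m 0 a = max (m - a) 0 := by
  have h : normalLaw m 0 = Measure.dirac m := by simp [normalLaw]
  rw [expImprovement, h, cdf_eq_real, measureReal_def, Measure.dirac_apply' _ measurableSet_Iic]
  rcases le_or_gt m a with hma | hma
  · rw [max_eq_right (by linarith)]
    simp [hma]
  · rw [max_eq_left (by linarith)]
    simp [hma]

lemma abs_expImprovement_le (m a : ℝ) {s : ℝ} (hs : 0 ≤ s) :
    |expImprovement m s a| ≤ |m - a| + s := by
  rcases hs.eq_or_lt with rfl | hs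
  · rw [expImprovement_zero, add_zero, abs_of_nonneg (le_max_right _ _)]
    exact max_le (le_abs_self _) (abs_nonneg _)
  · rw [expImprovement, normalDensity_of_pos m hs]
    refine (abs_add_le _ _).trans (add_le_add ?_ ?_)
    · rw [abs_mul]
      refine mul_le_of_le_one_right (abs_nonneg _) ?_
      rw [abs_le]
      constructor <;> linarith [cdf_nonneg (normalLaw m s) a, cdf_le_one (normalLaw m s) a]
    · have h0 : 0 ≤ stdPDF ((a - m) / s) := gaussianPDFReal_nonneg _ _ _
      rw [show s ^ 2 * (stdPDF ((a - m) / s) / s) = s * stdPDF ((a - m) / s) by field_simp,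
        abs_of_nonneg (by positivity)]
      exact mul_le_of_le_one_right hs.le (stdPDF_le_one _)

lemma continuous_stdExcess : Continuous stdExcess :=
  continuous_iff_continuousAt.2 fun z => (hasDerivAt_stdExcess z).continuousAt

lemma measurable_expImprovement {X : Type*} [MeasurableSpace X] {m s : X → ℝ} (hm : Measurable m)
    (hs : Measurable s) (hs0 : ∀ x, 0 ≤ s x) (a : ℝ) :
    Measurable fun x => expImprovement (m x) (s x) a := by
  have h : (fun x => expImprovement (m x) (s x) a) = fun x =>
      if s x = 0 then max (m x - a) 0 else s x * stdExcess ((a - m x) / s x) := by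
    ext x
    split_ifs with h
    · rw [h, expImprovement_zero]
    · exact expImprovement_of_pos _ ((hs0 x).lt_of_ne' h) a
  rw [h]
  refine Measurable.ite (hs (measurableSet_singleton 0)) (by fun_prop) ?_
  exact hs.mul (continuous_stdExcess.measurable.comp ((measurable_const.sub hm).div hs))

lemma expImprovement_affine (m s a c : ℝ) {t : ℝ} (ht : 0 < t) (hs : 0 ≤ s) :
    expImprovement (c + t * m) (t * s) a = t * expImprovement m s ((a - c) / t) := by
  rcases hs.eq_or_lt with rfl | hs
  · rw [mul_zero, expImprovement_zero, expImprovement_zero, mul_max_of_nonneg _ _ ht.le]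
    congr 1
    · field_simp
      ring
    · simp
  · rw [expImprovement_of_pos _ (by positivity), expImprovement_of_pos _ hs]
    rw [show (a - (c + t * m)) / (t * s) = ((a - c) / t - m) / s by field_simp; ring]
    ring

/-! ### Radial integrals of the Gaussian vector. -/

lemma pi_withDensity_ofReal {ι : Type*} [Fintype ι] {X : ι → Type*} [∀ i, MeasurableSpace (X i)]
    (μ : ∀ i, Measure (X i)) [∀ i, SigmaFinite (μ i)] {f : ∀ i, X i → ℝ}
    (hf : ∀ i, Integrable (f i) (μ i)) (hf0 : ∀ i x, 0 ≤ f i x) :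
    Measure.pi (fun i => (μ i).withDensity fun x => ENNReal.ofReal (f i x)) =
      (Measure.pi μ).withDensity fun x => ENNReal.ofReal (∏ i, f i (x i)) := by
  classical
  have hfin : ∀ i, IsFiniteMeasure ((μ i).withDensity fun x => ENNReal.ofReal (f i x)) :=
    fun i => isFiniteMeasure_withDensity_ofReal (hf i).2
  refine Measure.pi_eq fun s hs => ?_
  have hset : MeasurableSet (Set.univ.pi s) := MeasurableSet.univ_pi hs
  have hprod : ∀ x : ∀ i, X i, (Set.univ.pi s).indicator (fun x => ∏ i, f i (x i)) x =
      ∏ i, (s i).indicator (f i) (x i) := by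
    intro x
    by_cases hx : x ∈ Set.univ.pi s
    · rw [Set.indicator_of_mem hx]
      exact Finset.prod_congr rfl fun i _ => (Set.indicator_of_mem (hx i trivial) _).symm
    · rw [Set.indicator_of_notMem hx]
      simp only [Set.mem_pi, Set.mem_univ, true_implies, not_forall] at hx
      obtain ⟨i, hi⟩ := hx
      exact (Finset.prod_eq_zero (Finset.mem_univ i) (Set.indicator_of_notMem hi _)).symm
  have hint : Integrable (fun x : ∀ i, X i => ∏ i, f i (x i)) (Measure.pi μ) :=
    Integrable.fintype_prod_dep hf
  rw [withDensity_apply _ hset, ← ofReal_integral_eq_lintegral_ofReal hint.integrableOn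
    (ae_of_all _ fun x => Finset.prod_nonneg fun i _ => hf0 i _), ← integral_indicator hset]
  simp_rw [hprod]
  rw [integral_fintype_prod_eq_prod (fun i x => (s i).indicator (f i) x),
    ENNReal.ofReal_prod_of_nonneg]
  · refine Finset.prod_congr rfl fun i _ => ?_
    rw [integral_indicator (hs i), withDensity_apply _ (hs i),
      ofReal_integral_eq_lintegral_ofReal (hf i).integrableOn (ae_of_all _ (hf0 i))]
  · exact fun i _ => integral_nonneg fun x => Set.indicator_nonneg (fun y _ => hf0 i y) x

/-- The standard Gaussian law on `Fin m → ℝ`. -/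
noncomputable abbrev stdNormalPi (m : ℕ) : Measure (Fin m → ℝ) :=
  Measure.pi fun _ : Fin m => gaussianReal 0 1

/-- Polar coordinates. As C does not depend on f, the case f = 1 later eliminates it. -/
lemma integral_comp_norm_stdNormalPi {m : ℕ} (hm : 1 ≤ m) :
    ∃ C : ℝ, ∀ f : ℝ → ℝ, ∫ y, f (√(∑ i, y i ^ 2)) ∂(stdNormalPi m) =
      C * ∫ r in Set.Ioi (0 : ℝ), r ^ (m - 1) * (Real.exp (-r ^ 2 / 2) * f r) := by
  have : NeZero m := ⟨by omega⟩
  refine ⟨(√(2 * Real.pi))⁻¹ ^ m *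
    (m * (volume : Measure (EuclideanSpace ℝ (Fin m))).real (Metric.ball 0 1)), fun f => ?_⟩
  have hpi : stdNormalPi m = (volume : Measure (Fin m → ℝ)).withDensity
      fun y => ENNReal.ofReal (∏ i, stdPDF (y i)) := by
    rw [volume_pi, ← pi_withDensity_ofReal (fun _ : Fin m => (volume : Measure ℝ))
      (fun _ => integrable_gaussianPDFReal 0 1) (fun _ => gaussianPDFReal_nonneg 0 1)]
    simp only [stdNormalPi, gaussianReal_of_var_ne_zero 0 one_ne_zero]
    rfl
  have hprod : ∀ y : Fin m → ℝ, ∏ i, stdPDF (y i) =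
      (√(2 * Real.pi))⁻¹ ^ m * Real.exp (-(√(∑ i, y i ^ 2)) ^ 2 / 2) := by
    intro y
    simp_rw [stdPDF_eq]
    rw [Finset.prod_mul_distrib, ← Real.exp_sum, Real.sq_sqrt (by positivity)]
    simp [Finset.sum_div, neg_div]
  have hmeas : Measurable fun y : Fin m → ℝ => ∏ i, stdPDF (y i) :=
    Finset.measurable_prod _ fun i _ => continuous_stdPDF.measurable.comp (measurable_pi_apply i)
  rw [hpi, integral_withDensity_eq_integral_toReal_smul (by fun_prop) (by simp)]
  have hmp := (EuclideanSpace.volume_preserving_symm_measurableEquiv_toLp (Fin m)).symm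
  have hpolar := integral_fun_norm_addHaar (volume : Measure (EuclideanSpace ℝ (Fin m)))
    (fun r => (√(2 * Real.pi))⁻¹ ^ m * (Real.exp (-r ^ 2 / 2) * f r))
  rw [← (PiLp.volume_preserving_toLp (Fin m)).integral_comp
    (MeasurableEquiv.toLp 2 (Fin m → ℝ)).measurableEmbedding] at hpolar
  simp only [EuclideanSpace.norm_eq, Real.norm_eq_abs, sq_abs, finrank_euclideanSpace,
    Fintype.card_fin, smul_eq_mul, nsmul_eq_mul] at hpolar
  simp_rw [hprod]
  refine (integral_congr_ae (ae_of_all _ fun y => ?_)).trans (hpolar.trans ?_)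
  · simp only [smul_eq_mul]
    rw [ENNReal.toReal_ofReal (by positivity), mul_assoc]
  · simp_rw [mul_left_comm _ ((√(2 * Real.pi))⁻¹ ^ m), integral_const_mul]
    ring

lemma integral_comp_norm_stdNormalPi_mul {m : ℕ} (hm : 1 ≤ m) (f : ℝ → ℝ) :
    (∫ y, f (√(∑ i, y i ^ 2)) ∂(stdNormalPi m)) *
        ∫ r in Set.Ioi (0 : ℝ), r ^ (m - 1) * Real.exp (-r ^ 2 / 2) =
      ∫ r in Set.Ioi (0 : ℝ), r ^ (m - 1) * (Real.exp (-r ^ 2 / 2) * f r) := by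
  obtain ⟨C, hC⟩ := integral_comp_norm_stdNormalPi hm
  have h1 := hC fun _ => 1
  simp only [integral_const, probReal_univ, smul_eq_mul, mul_one] at h1
  rw [hC f]
  linear_combination (-∫ r in Set.Ioi (0 : ℝ), r ^ (m - 1) * (Real.exp (-r ^ 2 / 2) * f r)) * h1

/-! ### Law of the sample variance. -/

/-- The sum of the squared deviations of a sample from its mean. -/
noncomputable def sumSqDev {n : ℕ} (x : Fin n → ℝ) : ℝ := ∑ i, (x i - sampleMean x) ^ 2

lemma sumSqDev_eq {n : ℕ} (hn : n ≠ 0) (x : Fin n → ℝ) :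
    sumSqDev x = ∑ i, x i ^ 2 - (∑ i, x i) ^ 2 / n := by
  have hn' : (n : ℝ) ≠ 0 := by exact_mod_cast hn
  simp only [sumSqDev, sub_sq, Finset.sum_add_distrib, Finset.sum_sub_distrib, ← Finset.sum_mul,
    ← Finset.mul_sum, Finset.sum_const, Finset.card_univ, Fintype.card_fin, nsmul_eq_mul,
    sampleMean]
  field_simp
  ring

/-- In an orthonormal basis whose first vector v is constant, the sum of squared deviations is ‖x‖²
- ⟨v, x⟩², the sum of the squares of the other m coordinates; rotation invariance makes these
standard normal. -/
lemma map_sumSqDev_stdNormalPi (m : ℕ) :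
    (stdNormalPi (m + 1)).map sumSqDev = (stdNormalPi m).map fun y => ∑ i, y i ^ 2 := by
  set E := EuclideanSpace ℝ (Fin (m + 1))
  have hpos : (0 : ℝ) < (m : ℝ) + 1 := by positivity
  set v : E := WithLp.toLp 2 fun _ => (√((m : ℝ) + 1))⁻¹ with hv
  have hvn : ‖v‖ = 1 := by
    rw [EuclideanSpace.norm_eq]
    simp [hv, Real.sq_sqrt hpos.le, hpos.ne']
  -- Only the vector at index 0 is prescribed, so the constant family suffices.
  obtain ⟨b, hb⟩ := Orthonormal.exists_orthonormalBasis_extension_of_card_eq (𝕜 := ℝ) (E := E)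
    (ι := Fin (m + 1)) (by simp [E]) (v := fun _ => v) (s := {0})
    ⟨fun i => by simpa using hvn, fun i j hij => (hij (Subsingleton.elim _ _)).elim⟩
  have hb0 : b 0 = v := hb 0 rfl
  have hQ : Continuous (sumSqDev : (Fin (m + 1) → ℝ) → ℝ) := by
    unfold sumSqDev sampleMean
    fun_prop
  have hkey : ∀ y : Fin (m + 1) → ℝ, sumSqDev (WithLp.ofLp (∑ i, y i • b i)) =
      ∑ i : Fin m, y i.succ ^ 2 := by
    intro y
    set x : E := ∑ i, y i • b i with hx
    have h1 : ∑ i, x i ^ 2 = ∑ i, y i ^ 2 := by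
      rw [← EuclideanSpace.real_norm_sq_eq, hx, ← real_inner_self_eq_norm_sq,
        b.orthonormal.inner_sum]
      simp [sq]
    have h2 : (∑ i, x i) = √((m : ℝ) + 1) * y 0 := by
      have h3 : inner ℝ (b 0) x = y 0 := by
        rw [hx, b.orthonormal.inner_right_fintype]
      rw [hb0, hv, PiLp.inner_apply] at h3
      simp only [RCLike.inner_apply, conj_trivial, ← Finset.sum_mul] at h3
      rw [← h3]
      field_simp
    rw [sumSqDev_eq (Nat.succ_ne_zero m), h1, h2, mul_pow, Real.sq_sqrt hpos.le,
      Fin.sum_univ_succ]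
    push_cast
    field_simp
    ring
  have h1 : stdNormalPi (m + 1) = (stdNormalPi (m + 1)).map
      (fun y => WithLp.ofLp (∑ i, y i • b i)) := by
    have h2 : (stdNormalPi (m + 1)).map (WithLp.toLp 2) =
        (stdNormalPi (m + 1)).map (fun y => ∑ i, y i • b i) :=
      map_pi_eq_stdGaussian.trans (stdGaussian_eq_map_pi_orthonormalBasis b)
    have h3 := congrArg (Measure.map (WithLp.ofLp : E → _)) h2
    rw [Measure.map_map (by fun_prop) (by fun_prop), Measure.map_map (by fun_prop) (by fun_prop)]
      at h3
    exact Measure.map_id.symm.trans h3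
  have h4 : (stdNormalPi (m + 1)).map (fun y (i : Fin m) => y i.succ) = stdNormalPi m := by
    have := (measurePreserving_snd (μ := gaussianReal 0 1) (ν := stdNormalPi m)).comp
      (measurePreserving_piFinSuccAbove (fun _ : Fin (m + 1) => gaussianReal 0 1) 0)
    convert! this.map_eq using 1
  calc (stdNormalPi (m + 1)).map sumSqDev
      = (stdNormalPi (m + 1)).map (fun y => ∑ i : Fin m, y i.succ ^ 2) := by
        conv_lhs => rw [h1]
        rw [Measure.map_map hQ.measurable (by fun_prop)]
        congr 1
        exact funext hkey
    _ = _ := by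
        rw [← h4, Measure.map_map (by fun_prop) (by fun_prop)]
        rfl

/-! ### Stirling-type bound for the radial normaliser. -/

lemma one_le_mul_log_one_add_inv {k : ℝ} (hk : 0 < k) : 1 ≤ (k + 1 / 2) * Real.log (1 + k⁻¹) := by
  have h := Real.le_log_one_add_of_nonneg (inv_pos.2 hk).le
  have h2 : 2 * k⁻¹ / (k⁻¹ + 2) = 1 / (k + 1 / 2) := by field_simp; ring
  rw [h2, div_le_iff₀ (by linarith)] at h
  linarith

/-- The Stirling-type upper bound for the Gamma function is inherited by `k + 1` from `k`. -/
lemma Gamma_add_one_le_of_le {C k : ℝ} (hC : 0 ≤ C) (hk : 0 < k)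
    (h : Real.Gamma k ≤ C * Real.exp (-k) * k ^ (k - 1 / 2)) :
    Real.Gamma (k + 1) ≤ C * Real.exp (-(k + 1)) * (k + 1) ^ (k + 1 - 1 / 2) := by
  rw [Real.Gamma_add_one hk.ne']
  calc k * Real.Gamma k ≤ k * (C * Real.exp (-k) * k ^ (k - 1 / 2)) := by gcongr
    _ = C * (Real.exp (-k) * k ^ (k + 1 / 2)) := by
        rw [show k + 1 / 2 = (k - 1 / 2) + 1 by ring, Real.rpow_add_one hk.ne']
        ring
    _ ≤ C * (Real.exp (-(k + 1)) * (k + 1) ^ (k + 1 / 2)) := by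
        refine mul_le_mul_of_nonneg_left ?_ hC
        rw [Real.rpow_def_of_pos hk, Real.rpow_def_of_pos (by linarith), ← Real.exp_add,
          ← Real.exp_add, Real.exp_le_exp]
        have h1 := one_le_mul_log_one_add_inv hk
        have h2 : Real.log (1 + k⁻¹) = Real.log (k + 1) - Real.log k := by
          rw [← Real.log_div (by linarith) hk.ne']
          congr 1
          field_simp
        rw [h2] at h1
        nlinarith
    _ = _ := by
        rw [show k + 1 - 1 / 2 = k + 1 / 2 by ring]
        ring

lemma exp_one_le_pi_mul : Real.exp 1 ≤ Real.pi := by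
  linarith [Real.exp_one_lt_d9, Real.pi_gt_three]

/-- The argument advances by 1 every two steps, from 1/2 and from 1. The constant √(πe) gives
equality at 1/2; at 1 the bound amounts to e ≤ π. -/
lemma Gamma_half_nat_le (m : ℕ) :
    Real.Gamma (((m : ℝ) + 1) / 2) ≤ √(Real.pi * Real.exp 1) * Real.exp (-(((m : ℝ) + 1) / 2)) *
      (((m : ℝ) + 1) / 2) ^ (((m : ℝ) + 1) / 2 - 1 / 2) := by
  have hC : 0 ≤ √(Real.pi * Real.exp 1) := Real.sqrt_nonneg _
  induction m using Nat.twoStepInduction with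
  | zero =>
    have h : √(Real.exp 1) = Real.exp (1 / 2) := by
      rw [Real.sqrt_eq_iff_mul_self_eq_of_pos (Real.exp_pos _), ← Real.exp_add]
      norm_num
    simp only [Nat.cast_zero, zero_add, sub_self, Real.rpow_zero, mul_one, Real.Gamma_one_half_eq]
    rw [Real.sqrt_mul Real.pi_pos.le, h, mul_assoc, ← Real.exp_add]
    simp
  | one =>
    norm_num
    rw [Real.exp_neg, ← div_eq_mul_inv, le_div_iff₀ (Real.exp_pos 1), one_mul,
      Real.sqrt_mul Real.pi_pos.le]
    have := Real.sqrt_le_sqrt exp_one_le_pi_mul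
    nlinarith [Real.mul_self_sqrt (Real.exp_pos 1).le, Real.sqrt_nonneg (Real.exp 1)]
  | more m ih _ =>
    have := Gamma_add_one_le_of_le hC (by positivity) ih
    rw [show ((m + 2 : ℕ) : ℝ) + 1 = ((m : ℝ) + 1) + 2 by push_cast; ring, add_div,
      div_self two_ne_zero]
    exact this

lemma integral_pow_mul_exp_neg_half_sq_le (m : ℕ) :
    ∫ r in Set.Ioi (0 : ℝ), r ^ m * Real.exp (-r ^ 2 / 2) ≤
      √((m : ℝ) + 1) ^ m * Real.exp (-((m : ℝ) + 1) / 2) * √(Real.pi * Real.exp 1) / √2 := by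
  have hm : (-1 : ℝ) < m := by linarith [(Nat.cast_nonneg m : (0 : ℝ) ≤ m)]
  have h := integral_rpow_mul_exp_neg_mul_rpow (p := 2) (q := m) (b := 1 / 2) (by norm_num) hm
    (by norm_num)
  have h1 : ∫ r in Set.Ioi (0 : ℝ), r ^ m * Real.exp (-r ^ 2 / 2) =
      ∫ r in Set.Ioi (0 : ℝ), r ^ (m : ℝ) * Real.exp (-(1 / 2) * r ^ (2 : ℝ)) := by
    refine setIntegral_congr_fun measurableSet_Ioi fun r _ => ?_
    simp only [Real.rpow_natCast, Real.rpow_two]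
    congr 2
    ring
  rw [h1, h]
  have hk : (0 : ℝ) < ((m : ℝ) + 1) / 2 := by positivity
  calc _ ≤ (1 / 2 : ℝ) ^ (-((m : ℝ) + 1) / 2) * (1 / 2) *
        (√(Real.pi * Real.exp 1) * Real.exp (-(((m : ℝ) + 1) / 2)) *
      (((m : ℝ) + 1) / 2) ^ (((m : ℝ) + 1) / 2 - 1 / 2)) :=
        mul_le_mul_of_nonneg_left (Gamma_half_nat_le m) (by positivity)
    _ = _ := by
      have e1 : (1 / 2 : ℝ) ^ (-((m : ℝ) + 1) / 2) = 2 ^ ((m : ℝ) / 2) * √2 := by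
        rw [Real.sqrt_eq_rpow, ← Real.rpow_add two_pos, one_div, Real.inv_rpow two_pos.le,
          ← Real.rpow_neg two_pos.le]
        congr 1
        ring
      have e2 : (((m : ℝ) + 1) / 2) ^ (((m : ℝ) + 1) / 2 - 1 / 2) =
          √((m : ℝ) + 1) ^ m / 2 ^ ((m : ℝ) / 2) := by
        rw [show ((m : ℝ) + 1) / 2 - 1 / 2 = m / 2 by ring,
          Real.div_rpow (by positivity) two_pos.le, Real.sqrt_eq_rpow, ← Real.rpow_natCast,
          ← Real.rpow_mul (by positivity)]
        congr 2
        ring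
      rw [e1, e2, neg_div]
      have h3 : (2 : ℝ) ^ ((m : ℝ) / 2) ≠ 0 := (Real.rpow_pos_of_pos two_pos _).ne'
      have h4 : √2 * √2 = (2 : ℝ) := Real.mul_self_sqrt two_pos.le
      have h5 : √2 ≠ 0 := by positivity
      field_simp
      linear_combination h4

/-! ### Lower bound for the radial integral of the gap. -/

lemma exp_sub_half_sq_le_one_add {y : ℝ} (hy : 0 ≤ y) : Real.exp (y - y ^ 2 / 2) ≤ 1 + y := by
  rw [← Real.le_log_iff_exp_le (by linarith)]
  refine le_trans ?_ (Real.le_log_one_add_of_nonneg hy)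
  rw [le_div_iff₀ (by linarith)]
  nlinarith [pow_nonneg hy 3]

/-- The function `s + 1 / s - 2` for `s > 1`, extended by zero. -/
noncomputable def excessGap (s : ℝ) : ℝ := if 1 < s then s + s⁻¹ - 2 else 0

lemma excessGap_nonneg (s : ℝ) : 0 ≤ excessGap s := by
  unfold excessGap
  split_ifs with h
  · have : s + s⁻¹ - 2 = (s - 1) ^ 2 / s := by field_simp; ring
    rw [this]
    have : 0 < s := by linarith
    positivity
  · exact le_rfl

lemma excessGap_le {s : ℝ} (hs : 0 ≤ s) : excessGap s ≤ s := by
  unfold excessGap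
  split_ifs with h
  · linarith [inv_le_one_of_one_le₀ h.le]
  · exact hs

lemma measurable_excessGap : Measurable excessGap :=
  Measurable.ite (measurableSet_lt measurable_const measurable_id) (by fun_prop) measurable_const

/-- With u = 1 + y the gap is y²/u. The factor u^(m+1) is bounded below by the (m+1)-st power of
exp(y - y²/2), leaving a Gaussian in y, and the remaining u⁻² by its tangent (3v - 2u)/v³ at v. -/
lemma le_pow_mul_exp_mul_excessGap (m : ℕ) {v y : ℝ} (hv : 0 < v) (hy : 0 < y) :
    Real.exp (-((m : ℝ) + 1) / 2) *
        ((3 * v - 2 - 2 * y) / v ^ 3 * (y ^ 2 * Real.exp (-((m : ℝ) + 1) * y ^ 2))) ≤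
      (1 + y) ^ m * (Real.exp (-((m : ℝ) + 1) * (1 + y) ^ 2 / 2) * excessGap (1 + y)) := by
  have hu : 0 < 1 + y := by linarith
  have h1 : (3 * v - 2 - 2 * y) / v ^ 3 ≤ 1 / (1 + y) ^ 2 := by
    rw [div_le_div_iff₀ (by positivity) (by positivity)]
    have : 0 ≤ (v - (1 + y)) ^ 2 * (v + 2 * (1 + y)) := by positivity
    nlinarith
  have h2 : Real.exp (((m : ℝ) + 1) * (y - y ^ 2 / 2)) ≤ (1 + y) ^ (m + 1) := by
    have := pow_le_pow_left₀ (Real.exp_pos _).le (exp_sub_half_sq_le_one_add hy.le) (m + 1)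
    rw [← Real.exp_nat_mul] at this
    push_cast at this
    exact this
  have h3 : excessGap (1 + y) = y ^ 2 / (1 + y) := by
    rw [excessGap, if_pos (by linarith)]
    field_simp
    ring
  rw [h3]
  calc _ ≤ Real.exp (-((m : ℝ) + 1) / 2) *
        (1 / (1 + y) ^ 2 * (y ^ 2 * Real.exp (-((m : ℝ) + 1) * y ^ 2))) := by gcongr
    _ = Real.exp (((m : ℝ) + 1) * (y - y ^ 2 / 2)) *
        (Real.exp (-((m : ℝ) + 1) * (1 + y) ^ 2 / 2) * (y ^ 2 / (1 + y) ^ 2)) := by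
        have : Real.exp (-((m : ℝ) + 1) / 2) * Real.exp (-((m : ℝ) + 1) * y ^ 2) =
          Real.exp (((m : ℝ) + 1) * (y - y ^ 2 / 2)) *
            Real.exp (-((m : ℝ) + 1) * (1 + y) ^ 2 / 2) := by
          rw [← Real.exp_add, ← Real.exp_add]
          congr 1
          ring
        linear_combination (y ^ 2 / (1 + y) ^ 2) * this
    _ ≤ (1 + y) ^ (m + 1) *
        (Real.exp (-((m : ℝ) + 1) * (1 + y) ^ 2 / 2) * (y ^ 2 / (1 + y) ^ 2)) := by gcongr
    _ = _ := by
        field_simp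
        ring

lemma integral_sq_mul_exp_neg_mul_sq {t : ℝ} (ht : 0 < t) :
    ∫ y in Set.Ioi (0 : ℝ), y ^ 2 * Real.exp (-t ^ 2 * y ^ 2) = √Real.pi / (4 * t ^ 3) := by
  have h := integral_rpow_mul_exp_neg_mul_rpow (p := 2) (q := 2) (b := t ^ 2) (by norm_num)
    (by norm_num) (by positivity)
  simp only [Real.rpow_two] at h
  rw [h, show ((2 : ℝ) + 1) / 2 = 1 / 2 + 1 by norm_num, Real.Gamma_add_one (by norm_num),
    Real.Gamma_one_half_eq, ← Real.rpow_natCast, ← Real.rpow_mul ht.le,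
    show ((2 : ℕ) : ℝ) * (-(2 + 1) / 2) = -((3 : ℕ) : ℝ) by norm_num, Real.rpow_neg ht.le,
    Real.rpow_natCast]
  field_simp
  norm_num

lemma integral_cube_mul_exp_neg_mul_sq {t : ℝ} (ht : 0 < t) :
    ∫ y in Set.Ioi (0 : ℝ), y ^ 3 * Real.exp (-t ^ 2 * y ^ 2) = 1 / (2 * t ^ 4) := by
  have h := integral_rpow_mul_exp_neg_mul_rpow (p := 2) (q := (3 : ℕ)) (b := t ^ 2) (by norm_num)
    (by norm_num) (by positivity)
  simp only [Real.rpow_two, Real.rpow_natCast] at h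
  rw [h, show (((3 : ℕ) : ℝ) + 1) / 2 = 2 by norm_num, Real.Gamma_two, ← Real.rpow_natCast,
    ← Real.rpow_mul ht.le,
    show ((2 : ℕ) : ℝ) * (-(((3 : ℕ) : ℝ) + 1) / 2) = -((4 : ℕ) : ℝ) by norm_num,
    Real.rpow_neg ht.le, Real.rpow_natCast]
  field_simp

lemma integrableOn_pow_mul_exp_neg_mul_sq (k : ℕ) {b : ℝ} (hb : 0 < b) :
    IntegrableOn (fun y : ℝ => y ^ k * Real.exp (-b * y ^ 2)) (Set.Ioi 0) := by
  have := integrableOn_rpow_mul_exp_neg_mul_sq hb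
    (s := (k : ℝ)) (by linarith [(Nat.cast_nonneg k : (0 : ℝ) ≤ k)])
  simpa only [Real.rpow_natCast] using this

lemma setIntegral_Ioi_one_add (F : ℝ → ℝ) :
    ∫ s in Set.Ioi (1 : ℝ), F s = ∫ y in Set.Ioi (0 : ℝ), F (1 + y) := by
  rw [← integral_indicator measurableSet_Ioi, ← integral_indicator measurableSet_Ioi,
    ← integral_add_left_eq_self _ (1 : ℝ)]
  congr 1
  ext y
  simp only [Set.indicator, Set.mem_Ioi]
  congr 1
  simp

/-- Jensen's choice of tangent point: 1 + 2/(√π t) is the mean of 1 + y under the weight y²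
exp(-t²y²), so the tangent integrates to its value there times the total mass. -/
lemma integral_tangent_mul_exp {t : ℝ} (ht : 0 < t) :
    ∫ y in Set.Ioi (0 : ℝ), (3 * (1 + 2 / (√Real.pi * t)) - 2 - 2 * y) /
        (1 + 2 / (√Real.pi * t)) ^ 3 * (y ^ 2 * Real.exp (-t ^ 2 * y ^ 2)) =
      √Real.pi / (4 * t ^ 3) / (1 + 2 / (√Real.pi * t)) ^ 2 := by
  set v := 1 + 2 / (√Real.pi * t) with hv
  have hpi : 0 < √Real.pi := Real.sqrt_pos.2 Real.pi_pos
  have hv0 : 0 < v := by positivity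
  have e : ∀ y : ℝ, (3 * v - 2 - 2 * y) / v ^ 3 * (y ^ 2 * Real.exp (-t ^ 2 * y ^ 2)) =
      (3 * v - 2) / v ^ 3 * (y ^ 2 * Real.exp (-t ^ 2 * y ^ 2)) -
        2 / v ^ 3 * (y ^ 3 * Real.exp (-t ^ 2 * y ^ 2)) := fun y => by ring
  have hi : ∀ k : ℕ, IntegrableOn (fun y : ℝ => y ^ k * Real.exp (-t ^ 2 * y ^ 2)) (Set.Ioi 0) :=
    fun k => by simpa using integrableOn_pow_mul_exp_neg_mul_sq k (b := t ^ 2) (by positivity)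
  simp_rw [e]
  rw [integral_sub ((hi 2).const_mul _) ((hi 3).const_mul _), integral_const_mul,
    integral_const_mul, integral_sq_mul_exp_neg_mul_sq ht, integral_cube_mul_exp_neg_mul_sq ht]
  have h1 : 1 / (2 * t ^ 4) = (v - 1) * (√Real.pi / (4 * t ^ 3)) := by
    rw [hv]
    field_simp
    ring
  rw [h1]
  field_simp
  ring

lemma integrableOn_pow_mul_exp_mul_excessGap (m : ℕ) :
    IntegrableOn (fun s : ℝ => s ^ m * (Real.exp (-((m : ℝ) + 1) * s ^ 2 / 2) * excessGap s))
      (Set.Ioi 0) := by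
  have h := integrableOn_pow_mul_exp_neg_mul_sq (m + 1) (b := ((m : ℝ) + 1) / 2) (by positivity)
  refine Integrable.mono' h ?_ ?_
  · exact (Measurable.mul (by fun_prop)
      (Measurable.mul (by fun_prop) measurable_excessGap)).aestronglyMeasurable
  · refine (ae_restrict_iff' measurableSet_Ioi).2 (ae_of_all _ fun s hs => ?_)
    have hs0 : 0 < s := hs
    have h0 := excessGap_nonneg s
    rw [Real.norm_of_nonneg (by positivity), pow_succ s m, mul_assoc,
      show -((m : ℝ) + 1) * s ^ 2 / 2 = -(((m : ℝ) + 1) / 2) * s ^ 2 by ring,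
      mul_comm s (Real.exp _)]
    gcongr
    exact excessGap_le hs0.le

lemma le_integral_pow_mul_exp_mul_excessGap (m : ℕ) :
    Real.exp (-((m : ℝ) + 1) / 2) * (√Real.pi / (4 * √((m : ℝ) + 1) ^ 3) /
        (1 + 2 / (√Real.pi * √((m : ℝ) + 1))) ^ 2) ≤
      ∫ s in Set.Ioi (0 : ℝ), s ^ m * (Real.exp (-((m : ℝ) + 1) * s ^ 2 / 2) * excessGap s) := by
  have hm : (0 : ℝ) < (m : ℝ) + 1 := by positivity
  set t := √((m : ℝ) + 1) with ht
  have ht0 : 0 < t := Real.sqrt_pos.2 hm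
  have ht2 : t ^ 2 = (m : ℝ) + 1 := Real.sq_sqrt hm.le
  have hpi : 0 < √Real.pi := Real.sqrt_pos.2 Real.pi_pos
  set v := 1 + 2 / (√Real.pi * t) with hv
  have hv0 : 0 < v := by positivity
  have hint := integrableOn_pow_mul_exp_mul_excessGap m
  have hpos : ∀ s ∈ Set.Ioi (0 : ℝ),
      0 ≤ s ^ m * (Real.exp (-((m : ℝ) + 1) * s ^ 2 / 2) * excessGap s) := by
    intro s hs
    have hs0 : 0 < s := hs
    have h0 := excessGap_nonneg s
    positivity
  have h01 : Set.Ioi (1 : ℝ) ⊆ Set.Ioi 0 := Set.Ioi_subset_Ioi zero_le_one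
  refine le_trans ?_ (setIntegral_mono_set hint
    ((ae_restrict_iff' measurableSet_Ioi).2 (ae_of_all _ hpos)) h01.eventuallyLE)
  rw [setIntegral_Ioi_one_add, ← integral_tangent_mul_exp ht0, ← integral_const_mul]
  have hi : ∀ k : ℕ, IntegrableOn (fun y : ℝ => y ^ k * Real.exp (-t ^ 2 * y ^ 2)) (Set.Ioi 0) :=
    fun k => by simpa using integrableOn_pow_mul_exp_neg_mul_sq k (b := t ^ 2) (by positivity)
  refine setIntegral_mono_on ?_ ?_ measurableSet_Ioi fun y hy => ?_
  · have := ((hi 2).const_mul ((3 * v - 2) / v ^ 3)).sub ((hi 3).const_mul (2 / v ^ 3))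
    refine Integrable.const_mul (this.congr (ae_of_all _ fun y => ?_)) _
    simp only [Pi.sub_apply]
    ring
  · have h1 := (integrable_indicator_iff measurableSet_Ioi).2 (hint.mono_set h01)
    have h2 := h1.comp_add_left 1
    rw [← integrable_indicator_iff measurableSet_Ioi]
    refine h2.congr (ae_of_all _ fun y => ?_)
    simp [Set.indicator]
  · rw [ht2]
    exact le_pow_mul_exp_mul_excessGap m hv0 hy

lemma integral_scaled_excessGap (m : ℕ) :
    ∫ r in Set.Ioi (0 : ℝ), r ^ m * (Real.exp (-r ^ 2 / 2) * excessGap (r / √((m : ℝ) + 1))) =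
      √((m : ℝ) + 1) ^ (m + 1) *
        ∫ s in Set.Ioi (0 : ℝ), s ^ m * (Real.exp (-((m : ℝ) + 1) * s ^ 2 / 2) * excessGap s) := by
  have hm : (0 : ℝ) < (m : ℝ) + 1 := by positivity
  set t := √((m : ℝ) + 1) with ht
  have ht0 : 0 < t := Real.sqrt_pos.2 hm
  have ht2 : t ^ 2 = (m : ℝ) + 1 := Real.sq_sqrt hm.le
  have h := integral_comp_mul_left_Ioi'
    (fun r : ℝ => r ^ m * (Real.exp (-r ^ 2 / 2) * excessGap (r / t))) 0 ht0
  rw [mul_zero] at h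
  rw [← h, smul_eq_mul, ← integral_const_mul, ← integral_const_mul]
  refine integral_congr_ae (ae_of_all _ fun s => ?_)
  simp only
  rw [mul_div_cancel_left₀ _ ht0.ne', mul_pow, mul_pow, ht2, neg_mul]
  ring

/-- Applied with t = √(n - 1). Cauchy–Schwarz for (t, 1) and (1, 2/√π) produces t² + 1 = n, leaving
the numerical inequality 4e⁻²(1 + 4/π) ≤ √2. -/
lemma exp_neg_div_le_of_sqrt {t : ℝ} (ht : 0 < t) :
    Real.exp (-(5 / 2)) / (t ^ 2 + 1) * (√(Real.pi * Real.exp 1) / √2) ≤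
      t * (√Real.pi / (4 * t ^ 3) / (1 + 2 / (√Real.pi * t)) ^ 2) := by
  have hpi : 0 < √Real.pi := Real.sqrt_pos.2 Real.pi_pos
  have hpi2 : √Real.pi ^ 2 = Real.pi := Real.sq_sqrt Real.pi_pos.le
  have he : √(Real.exp 1) = Real.exp (1 / 2) := by
    rw [Real.sqrt_eq_iff_mul_self_eq_of_pos (Real.exp_pos _), ← Real.exp_add]
    norm_num
  have h2 : (1.414 : ℝ) ≤ √2 := Real.le_sqrt_of_sq_le (by norm_num)
  have hcauchy : (t + 2 / √Real.pi) ^ 2 ≤ (t ^ 2 + 1) * (1 + 4 / Real.pi) := by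
    have e : 4 / Real.pi = (2 / √Real.pi) ^ 2 := by
      rw [div_pow, hpi2]
      norm_num
    rw [e]
    nlinarith [sq_nonneg (t * (2 / √Real.pi) - 1)]
  have hexp : Real.exp (-(5 / 2)) * Real.exp (1 / 2) = (Real.exp 1 ^ 2)⁻¹ := by
    rw [← Real.exp_add, ← Real.exp_nat_mul, ← Real.exp_neg]
    norm_num
  have hconst : (Real.exp 1 ^ 2)⁻¹ * 4 * (1 + 4 / Real.pi) ≤ √2 := by
    refine le_trans ?_ h2
    have h3 : 4 / Real.pi ≤ 4 / 3.14 := by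
      gcongr
      exact Real.pi_gt_d2.le
    have h4 : (7.38 : ℝ) ≤ Real.exp 1 ^ 2 := by nlinarith [Real.exp_one_gt_d9]
    have h5 : (Real.exp 1 ^ 2)⁻¹ ≤ 7.38⁻¹ := inv_anti₀ (by norm_num) h4
    calc _ ≤ (7.38 : ℝ)⁻¹ * 4 * (1 + 4 / 3.14) := by gcongr
      _ ≤ _ := by norm_num
  have hrhs : t * (√Real.pi / (4 * t ^ 3) / (1 + 2 / (√Real.pi * t)) ^ 2) =
      √Real.pi / (4 * (t + 2 / √Real.pi) ^ 2) := by
    field_simp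
  have hlhs : Real.exp (-(5 / 2)) / (t ^ 2 + 1) * (√(Real.pi * Real.exp 1) / √2) =
      √Real.pi * ((Real.exp 1 ^ 2)⁻¹ / ((t ^ 2 + 1) * √2)) := by
    rw [Real.sqrt_mul Real.pi_pos.le, he, ← hexp]
    field_simp
  rw [hrhs, hlhs, div_eq_mul_one_div (√Real.pi)]
  refine mul_le_mul_of_nonneg_left ?_ hpi.le
  rw [div_le_div_iff₀ (by positivity) (by positivity)]
  calc (Real.exp 1 ^ 2)⁻¹ * (4 * (t + 2 / √Real.pi) ^ 2)
      ≤ (Real.exp 1 ^ 2)⁻¹ * (4 * ((t ^ 2 + 1) * (1 + 4 / Real.pi))) := by gcongr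
    _ = (t ^ 2 + 1) * ((Real.exp 1 ^ 2)⁻¹ * 4 * (1 + 4 / Real.pi)) := by ring
    _ ≤ (t ^ 2 + 1) * √2 := by gcongr
    _ = _ := by ring

/-! ### Expected gap of the sample deviation. -/

lemma sampleSD_eq {m : ℕ} (x : Fin (m + 2) → ℝ) :
    sampleSD x = √(sumSqDev x) / √((m : ℝ) + 1) := by
  have hpos : 0 ≤ sumSqDev x := Finset.sum_nonneg fun i _ => sq_nonneg _
  rw [← Real.sqrt_div hpos, sampleSD, sumSqDev]
  congr 2
  push_cast
  ring

lemma integral_excessGap_sampleSD_ge (m : ℕ) :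
    Real.exp (-(5 / 2)) / ((m : ℝ) + 2) ≤
      ∫ x, excessGap (sampleSD x) ∂(stdNormalPi (m + 2)) := by
  have hm : (0 : ℝ) < (m : ℝ) + 1 := by positivity
  have hQ : Continuous (sumSqDev : (Fin (m + 2) → ℝ) → ℝ) := by
    unfold sumSqDev sampleMean
    fun_prop
  set t := √((m : ℝ) + 1) with ht
  have ht0 : 0 < t := Real.sqrt_pos.2 hm
  have ht2 : t ^ 2 = (m : ℝ) + 1 := Real.sq_sqrt hm.le
  have hg : Measurable fun q : ℝ => excessGap (√q / t) :=
    measurable_excessGap.comp (by fun_prop)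
  have h1 : ∫ x, excessGap (sampleSD x) ∂(stdNormalPi (m + 2)) =
      ∫ y, excessGap (√(∑ i, y i ^ 2) / t) ∂(stdNormalPi (m + 1)) := by
    simp_rw [sampleSD_eq]
    rw [← integral_map (φ := sumSqDev) hQ.aemeasurable hg.aestronglyMeasurable,
      map_sumSqDev_stdNormalPi, integral_map (Measurable.aemeasurable (by fun_prop)) hg.aestronglyMeasurable]
  have h2 := integral_comp_norm_stdNormalPi_mul (m := m + 1) (by omega)
    (fun r => excessGap (r / t))
  rw [← h1, Nat.add_sub_cancel, integral_scaled_excessGap, ← ht] at h2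
  set E := ∫ x, excessGap (sampleSD x) ∂(stdNormalPi (m + 2))
  have hE : 0 ≤ E := integral_nonneg fun x => excessGap_nonneg _
  have h3 := le_integral_pow_mul_exp_mul_excessGap m
  have h4 := integral_pow_mul_exp_neg_half_sq_le m
  rw [← ht] at h3 h4
  have h5 := exp_neg_div_le_of_sqrt ht0
  rw [ht2, show (m : ℝ) + 1 + 1 = (m : ℝ) + 2 by ring] at h5
  -- This is the upper bound for the normaliser; the lower bound for the numerator shares its first
  -- two factors.
  have hw : 0 < t ^ m * Real.exp (-((m : ℝ) + 1) / 2) * (√(Real.pi * Real.exp 1) / √2) := by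
    have := Real.pi_pos
    positivity
  refine le_of_mul_le_mul_right ?_ hw
  calc _ = t ^ m * Real.exp (-((m : ℝ) + 1) / 2) *
        (Real.exp (-(5 / 2)) / ((m : ℝ) + 2) * (√(Real.pi * Real.exp 1) / √2)) := by ring
    _ ≤ t ^ m * Real.exp (-((m : ℝ) + 1) / 2) *
        (t * (√Real.pi / (4 * t ^ 3) / (1 + 2 / (√Real.pi * t)) ^ 2)) := by gcongr
    _ = t ^ (m + 1) * (Real.exp (-((m : ℝ) + 1) / 2) *
        (√Real.pi / (4 * t ^ 3) / (1 + 2 / (√Real.pi * t)) ^ 2)) := by ring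
    _ ≤ _ := mul_le_mul_of_nonneg_left h3 (by positivity)
    _ = _ := h2.symm
    _ ≤ E * (t ^ m * Real.exp (-((m : ℝ) + 1) / 2) * √(Real.pi * Real.exp 1) / √2) :=
        mul_le_mul_of_nonneg_left h4 hE
    _ = _ := by ring

/-! ### Equivariance, integrability and symmetrisation. -/

lemma continuous_sampleMean {n : ℕ} : Continuous (sampleMean : (Fin n → ℝ) → ℝ) := by
  unfold sampleMean
  fun_prop

lemma continuous_sampleSD {n : ℕ} : Continuous (sampleSD : (Fin n → ℝ) → ℝ) := by
  unfold sampleSD sampleMean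
  fun_prop

lemma sampleSD_nonneg {n : ℕ} (x : Fin n → ℝ) : 0 ≤ sampleSD x := Real.sqrt_nonneg _

lemma sampleMean_affine {n : ℕ} (hn : n ≠ 0) (μ σ : ℝ) (x : Fin n → ℝ) :
    sampleMean (fun i => μ + σ * x i) = μ + σ * sampleMean x := by
  have hn' : (n : ℝ) ≠ 0 := by exact_mod_cast hn
  simp only [sampleMean, Finset.sum_add_distrib, ← Finset.mul_sum, Finset.sum_const,
    Finset.card_univ, Fintype.card_fin, nsmul_eq_mul]
  field_simp

lemma sampleSD_affine {n : ℕ} (hn : n ≠ 0) (μ σ : ℝ) (x : Fin n → ℝ) :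
    sampleSD (fun i => μ + σ * x i) = |σ| * sampleSD x := by
  rw [sampleSD, sampleSD, sampleMean_affine hn, ← Real.sqrt_sq_eq_abs,
    ← Real.sqrt_mul (sq_nonneg _), ← mul_div_assoc, Finset.mul_sum]
  congr 3
  ext i
  ring

lemma integrable_eval_stdNormalPi (n : ℕ) (i : Fin n) :
    Integrable (fun x : Fin n → ℝ => x i) (stdNormalPi n) :=
  integrable_comp_eval (μ := fun _ : Fin n => gaussianReal 0 1) (i := i) (f := id)
    IsGaussian.integrable_id

lemma integrable_sampleMean (n : ℕ) : Integrable (sampleMean : (Fin n → ℝ) → ℝ)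
    (stdNormalPi n) :=
  (integrable_finsetSum _ fun i _ => integrable_eval_stdNormalPi n i).div_const _

lemma integrable_sampleSD {n : ℕ} (hn : 2 ≤ n) : Integrable (sampleSD : (Fin n → ℝ) → ℝ)
    (stdNormalPi n) := by
  have hn' : (2 : ℝ) ≤ n := by exact_mod_cast hn
  refine Integrable.mono' (integrable_finsetSum Finset.univ fun i _ =>
    ((integrable_eval_stdNormalPi n i).sub (integrable_sampleMean n)).abs)
    continuous_sampleSD.aestronglyMeasurable (ae_of_all _ fun x => ?_)
  rw [Real.norm_of_nonneg (sampleSD_nonneg x)]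
  refine Real.sqrt_le_iff.2 ⟨Finset.sum_nonneg fun i _ => abs_nonneg _, ?_⟩
  refine (div_le_self (Finset.sum_nonneg fun i _ => sq_nonneg _) (by linarith)).trans ?_
  -- The ℓ² norm of the deviations is at most their ℓ¹ norm, which is integrable.
  have := Finset.sum_sq_le_sq_sum_of_nonneg (s := Finset.univ)
    (f := fun i => |x i - sampleMean x|) fun i _ => abs_nonneg _
  simpa only [sq_abs, Pi.sub_apply] using this

lemma integrable_expImprovement_sample {n : ℕ} (hn : 2 ≤ n) (a : ℝ) :
    Integrable (fun x : Fin n → ℝ => expImprovement (sampleMean x) (sampleSD x) a)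
      (stdNormalPi n) := by
  refine Integrable.mono' (((integrable_sampleMean n).sub (integrable_const a)).abs.add
    (integrable_sampleSD hn)) (measurable_expImprovement continuous_sampleMean.measurable
      continuous_sampleSD.measurable sampleSD_nonneg a).aestronglyMeasurable
    (ae_of_all _ fun x => ?_)
  simpa using abs_expImprovement_le (sampleMean x) a (sampleSD_nonneg x)

lemma normalLaw_pi_eq_map (μ σ : ℝ) (n : ℕ) :
    Measure.pi (fun _ : Fin n => normalLaw μ σ) =
      (stdNormalPi n).map fun x i => μ + σ * x i := by
  have (_ : Fin n) : SigmaFinite ((gaussianReal 0 1).map fun y => μ + σ * y) := by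
    rw [← normalLaw_eq_map, normalLaw]
    infer_instance
  have h := Measure.pi_map_pi (μ := fun _ : Fin n => gaussianReal 0 1)
    (f := fun _ y => μ + σ * y) fun _ => Measurable.aemeasurable (by fun_prop)
  rw [h, normalLaw_eq_map]

lemma stdNormalPi_map_neg (n : ℕ) : (stdNormalPi n).map (fun x => -x) = stdNormalPi n := by
  -- A scale of -1 is allowed here: only σ² enters `normalLaw`.
  have h := normalLaw_pi_eq_map 0 (-1) n
  simp only [normalLaw, zero_add, neg_mul, one_mul] at h
  have h2 : ((-1 : ℝ) ^ 2).toNNReal = 1 := by norm_num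
  rw [h2] at h
  exact h.symm

lemma errMA_eq (μ : ℝ) {σ : ℝ} (hσ : 0 < σ) {n : ℕ} (hn : n ≠ 0) (α : ℝ) :
    errMA μ σ n α = σ * ∫ x, |stdExcess ((α - μ) / σ) -
      expImprovement (sampleMean x) (sampleSD x) ((α - μ) / σ)| ∂(stdNormalPi n) := by
  have hmeas : Measurable fun x : Fin n → ℝ =>
      |expImprovement μ σ α - expImprovement (sampleMean x) (sampleSD x) α| :=
    (measurable_const.sub (measurable_expImprovement continuous_sampleMean.measurable
      continuous_sampleSD.measurable sampleSD_nonneg α)).abs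
  rw [errMA, normalLaw_pi_eq_map, integral_map (Measurable.aemeasurable (by fun_prop))
    hmeas.aestronglyMeasurable, ← integral_const_mul]
  refine integral_congr_ae (ae_of_all _ fun x => ?_)
  simp only
  rw [sampleMean_affine hn, sampleSD_affine hn, abs_of_pos hσ,
    expImprovement_affine _ _ _ _ hσ (sampleSD_nonneg x), expImprovement_of_pos _ hσ, ← mul_sub,
    abs_mul, abs_of_pos hσ]

/-- Pairing x with -x lets convexity cancel the sample mean; for σ̂ ≤ 1 the left side is zero. -/
lemma excessGap_sampleSD_le {n : ℕ} (hn : n ≠ 0) (z : ℝ) (x : Fin n → ℝ) :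
    2 * (stdPDF z * (Real.exp 1 / 2) * z ^ 2 * excessGap (sampleSD x)) ≤
      |stdExcess z - expImprovement (sampleMean x) (sampleSD x) z| +
      |stdExcess z - expImprovement (sampleMean (-x)) (sampleSD (-x)) z| := by
  rw [excessGap]
  split_ifs with hs
  · have hmean : sampleMean (-x) = -sampleMean x := by
      simpa [Pi.neg_def] using sampleMean_affine hn 0 (-1) x
    have hsd : sampleSD (-x) = sampleSD x := by
      simpa [Pi.neg_def] using sampleSD_affine hn 0 (-1) x
    have hs0 : 0 < sampleSD x := by linarith
    rw [hmean, hsd, expImprovement_of_pos _ hs0, expImprovement_of_pos _ hs0]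
    have h1 := mul_stdExcess_div_sub_ge z hs.le
    have h2 := mul_le_mul_of_nonneg_left
      (two_mul_stdExcess_le (z / sampleSD x) (sampleMean x / sampleSD x)) hs0.le
    rw [← sub_div, ← add_div] at h2
    rw [sub_neg_eq_add]
    have h3 := neg_abs_le (stdExcess z - sampleSD x * stdExcess ((z - sampleMean x) / sampleSD x))
    have h4 := neg_abs_le (stdExcess z - sampleSD x * stdExcess ((z + sampleMean x) / sampleSD x))
    linarith
  · rw [mul_zero, mul_zero]
    positivity

lemma le_integral_abs_stdExcess_sub {n : ℕ} (hn : 2 ≤ n) (z : ℝ) :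
    stdPDF z * (Real.exp 1 / 2) * z ^ 2 * (Real.exp (-(5 / 2)) / n) ≤
      ∫ x, |stdExcess z - expImprovement (sampleMean x) (sampleSD x) z| ∂(stdNormalPi n) := by
  obtain ⟨m, rfl⟩ := Nat.exists_eq_add_of_le' hn
  set H : (Fin (m + 2) → ℝ) → ℝ := fun x =>
    |stdExcess z - expImprovement (sampleMean x) (sampleSD x) z| with hH
  have hHi : Integrable H (stdNormalPi (m + 2)) :=
    ((integrable_const _).sub (integrable_expImprovement_sample hn z)).abs
  have hneg : MeasurePreserving (fun x : Fin (m + 2) → ℝ => -x) (stdNormalPi (m + 2))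
      (stdNormalPi (m + 2)) := ⟨by fun_prop, stdNormalPi_map_neg _⟩
  have hHi' : Integrable (fun x => H (-x)) (stdNormalPi (m + 2)) :=
    hneg.integrable_comp_of_integrable hHi
  have hHe : ∫ x, H (-x) ∂(stdNormalPi (m + 2)) = ∫ x, H x ∂(stdNormalPi (m + 2)) :=
    hneg.integral_comp (MeasurableEquiv.neg _).measurableEmbedding H
  have hgi : Integrable (fun x => excessGap (sampleSD x)) (stdNormalPi (m + 2)) := by
    refine (integrable_sampleSD hn).mono'
      (measurable_excessGap.comp continuous_sampleSD.measurable).aestronglyMeasurable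
      (ae_of_all _ fun x => ?_)
    rw [Real.norm_of_nonneg (excessGap_nonneg _)]
    exact excessGap_le (sampleSD_nonneg x)
  have hC : 0 ≤ stdPDF z * (Real.exp 1 / 2) * z ^ 2 := by
    have : 0 ≤ stdPDF z := gaussianPDFReal_nonneg _ _ _
    positivity
  have h := integral_mono ((hgi.const_mul (stdPDF z * (Real.exp 1 / 2) * z ^ 2)).const_mul 2)
    (hHi.add hHi') fun x => excessGap_sampleSD_le (by omega) z x
  rw [integral_const_mul, integral_const_mul, integral_add' hHi hHi', hHe] at h
  have h2 := mul_le_mul_of_nonneg_left (integral_excessGap_sampleSD_ge m) hC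
  push_cast
  linarith

/-! ### The two lower bounds. -/

lemma le_errMA (μ : ℝ) {σ : ℝ} (hσ : 0 < σ) {n : ℕ} (hn : 2 ≤ n) (α : ℝ) :
    σ / (2 * Real.exp (3 / 2) * n) * ((α - μ) / σ) ^ 2 * normalDensity 0 1 ((α - μ) / σ) ≤
      errMA μ σ n α := by
  rw [errMA_eq μ hσ (by omega), normalDensity_of_pos 0 one_pos, sub_zero, div_one, div_one]
  have h := mul_le_mul_of_nonneg_left (le_integral_abs_stdExcess_sub hn ((α - μ) / σ)) hσ.le
  have he : Real.exp (-(5 / 2)) * Real.exp 1 = (Real.exp (3 / 2))⁻¹ := by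
    rw [← Real.exp_add, ← Real.exp_neg]
    norm_num
  refine le_trans (le_of_eq ?_) h
  have hn0 : (n : ℝ) ≠ 0 := by positivity
  generalize stdPDF ((α - μ) / σ) = p
  generalize (α - μ) / σ = z
  calc σ / (2 * Real.exp (3 / 2) * n) * z ^ 2 * p
      = σ / (2 * n) * z ^ 2 * p * (Real.exp (3 / 2))⁻¹ := by field_simp
    _ = σ / (2 * n) * z ^ 2 * p * (Real.exp (-(5 / 2)) * Real.exp 1) := by rw [he]
    _ = _ := by field_simp

/-- From α = μ + σz, α² ≤ 2μ² + 2σ²z², and z² ≥ 3/2 gives 2μ² ≤ (4/3)μ²z². -/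
lemma sq_le_mul_sq_of_sqrt_le {μ σ α : ℝ} (hσ : 0 < σ) (hα : μ + √(3 / 2) * σ ≤ α) :
    α ^ 2 ≤ (4 / 3 * μ ^ 2 + 2 * σ ^ 2) * ((α - μ) / σ) ^ 2 := by
  have h1 : √(3 / 2) ≤ (α - μ) / σ := by
    rw [le_div_iff₀ hσ]
    linarith
  have h2 : 3 / 2 ≤ ((α - μ) / σ) ^ 2 := by
    have := pow_le_pow_left₀ (Real.sqrt_nonneg _) h1 2
    rwa [Real.sq_sqrt (by norm_num)] at this
  have h3 : α = μ + σ * ((α - μ) / σ) := by field_simp; ring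
  generalize (α - μ) / σ = z at *
  rw [h3]
  nlinarith [sq_nonneg (μ - σ * z), mul_nonneg (sq_nonneg μ) (sub_nonneg.2 h2)]

theorem mainTheorem4 (μ σ : ℝ) (hσ : 0 < σ) :
    (∀ n : ℕ, 2 ≤ n → ∀ α : ℝ, μ + Real.sqrt (3 / 2) * σ ≤ α →
      σ / (2 * Real.exp (3 / 2) * n) * ((α - μ) / σ) ^ 2 * normalDensity 0 1 ((α - μ) / σ)
        ≤ errMA μ σ n α) ∧
    (∃ c : ℝ, 0 < c ∧ ∀ n : ℕ, 2 ≤ n → ∀ α : ℝ, μ + Real.sqrt (3 / 2) * σ ≤ α →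
      c * (α ^ 2 * normalDensity μ σ α / n) ≤ errMA μ σ n α) := by
  refine ⟨fun n hn α _ => le_errMA μ hσ hn α, ?_⟩
  have hK : 0 < 4 / 3 * μ ^ 2 + 2 * σ ^ 2 := by positivity
  refine ⟨σ ^ 2 / (2 * Real.exp (3 / 2)) / (4 / 3 * μ ^ 2 + 2 * σ ^ 2), by positivity,
    fun n hn α hα => le_trans ?_ (le_errMA μ hσ hn α)⟩
  rw [normalDensity_of_pos μ hσ, normalDensity_of_pos 0 one_pos, sub_zero, div_one, div_one]
  have hp : 0 ≤ stdPDF ((α - μ) / σ) := gaussianPDFReal_nonneg _ _ _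
  have hn0 : (0 : ℝ) < n := by positivity
  have h := sq_le_mul_sq_of_sqrt_le hσ hα
  generalize stdPDF ((α - μ) / σ) = p at *
  generalize (α - μ) / σ = z at *
  calc _ ≤ σ ^ 2 / (2 * Real.exp (3 / 2)) / (4 / 3 * μ ^ 2 + 2 * σ ^ 2) *
        ((4 / 3 * μ ^ 2 + 2 * σ ^ 2) * z ^ 2 * (p / σ) / n) := by gcongr
    _ = _ := by field_simp
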